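/- A binary word is $1$-decreasing if every factor of it of the form $0^a1^b$ with $a>0$ that cannot be extended to a longer factor of this form satisfies $a>b$. Let $\mathcal W^1_n$ be the set of $1$-decreasing words of length $n$. A $1$-Gray code for a set of words of the same length is a list containing every word of the set exactly once, and no other word, in which any two consecutive words differ in at most one position. For lists, $\circ$ (and $\bigcirc_j$, in the indicated order of $j$; empty if there is no $j$ in the range) denotes concatenation, $\overline{L}$ is the reverse of $L$, $\langle L\rangle^i$ is $L$ for even $i$ and $\overline L$ for odd $i$, $\mathrm{first}(L)$ and $\mathrm{last}(L)$ are the first and last word of $L$, $\widehat L$ is $L$ without its first word, and $w\cdot L$ (or $wL$) is the list obtained by writing the word $w$ in front of every word of $L$; a word also stands for the list that contains only that word, and $\epsilon$ is the empty word. Let $(001)^\star$ denote the prefix of the appropriate length of the infinite word $001001001\cdots$. Define lists $\mathbb Z_n$ recursively. Put $\mathbb Z_0=\epsilon$, $\mathbb Z_1=0$, $\mathbb Z_2=00$, $\mathbb Z_3=000\circ001$. For $n\ge4$ put $$\mathbb Z_n=\begin{cases} \Delta_n^5\circ\Delta_n^9\circ\cdots\circ\Delta_n^{n}\circ0^n\circ\Delta_n^{n-2}\circ\cdots\circ\Delta_n^7\circ\Delta_n^3,&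 n\equiv1 \pmod 4,\\ \Delta_n^5\circ\Delta_n^9\circ\cdots\circ\Delta_n^{n-1}\circ0^n\circ\Delta_n^{n-3}\circ\cdots\circ\Delta_n^7\circ\Delta_n^3,& n\equiv2 \pmod 4,\\ \Delta_n^5\circ\Delta_n^9\circ\cdots\circ\Delta_n^{n-2}\circ0^n\circ\Delta_n^{n}\circ\cdots\circ\Delta_n^7\circ\Delta_n^3,& n\equiv3 \pmod 4,\\ \Delta_n^5\circ\Delta_n^9\circ\cdots\circ\Delta_n^{n-3}\circ0^{n-1}1\circ0^n\circ\Delta_n^{n-1}\circ\cdots\circ\Delta_n^7\circ\Delta_n^3,& n\equiv0 \pmod 4, \end{cases}$$ where the upper indices before $0^n$ run through the numbers $\equiv1\pmod 4$ from $5$ up to the one shown (none if that one is less than $5$) and those after $0^n$ run through the numbers $\equiv 3\pmod 4$ from the one shown down to $3$. The lists $\Delta^r_n$ are as follows. For $r\equiv1\pmod4$, $r\ne n-1$: $$\Delta_n^r=\bigcirc_{j=1}^{\frac{r-3}2}0^{r-1-j}1^j\cdot\langle\mathbb Z_{n-r+1}\rangle^j\circ\overline{\bigcirc_{j=1}^{\frac{r-1}2}0^{r-j}1^j\cdot\langle\mathbb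 Z_{n-r}\rangle^j}.$$ For $r\equiv1\pmod4$, $r=n-1$: $$\Delta_n^{n-1}=\bigcirc_{j=1}^{\frac{n-4}2}0^{n-2-j}1^j00\circ0^{\frac n2}1^{\frac{n-2}2}0\circ\overline{\bigcirc_{j=1}^{\frac{n-4}2}\langle0^{n-j-1}1^{j+1}\circ0^{n-1-j}1^j0\rangle^{j-1}}\circ0^{n-1}1.$$ For $r\equiv3\pmod4$, in the first of the following cases that applies: if $r=3$, $\Delta_n^3=001\,\mathbb Z_{n-3}$; if $r=n-2$, $$\Delta_n^{n-2}=\bigcirc_{j=1}^{\frac{n-5}2}0^{n-3-j}1^j\langle\mathbb Z_3\rangle^{j-1}\circ\overline{\bigcirc_{j=1}^{\frac{n-3}2}0^{n-2-j}1^j\mathbb Z_2};$$ if $r=n-1$, $$\Delta_n^{n-1}=\bigcirc_{j=1}^{\frac{n-4}2}0^{n-2-j}1^j\mathbb Z_2\circ0^{\frac n2}1^{\frac{n-2}2}\mathbb Z_1\circ\overline{\bigcirc_{j=1}^{\frac{n-4}2}\langle0^{n-1-j}1^{j+1}\circ0^{n-1-j}1^j\mathbb Z_1\rangle^{j}};$$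 if $r=n$, $$\Delta_n^{n}=\bigcirc_{j=1}^{\frac{n-3}2}0^{n-1-j}1^j0\circ\overline{\bigcirc_{j=1}^{\frac{n-1}2}0^{n-j}1^j};$$ otherwise, with $a=\frac{r-3}2$, $\mathbb K_i=0^{r-1-i}1^i\mathbb Z_{n-r+1}$ and $\mathbb L_i=0^{r-i}1^i\mathbb Z_{n-r}$, $$\Delta_n^r=\bigcirc_{i=1}^{a+1}\mathrm{first}(\mathbb L_i)\circ\bigcirc_{i=a}^{1}\langle\widehat{\mathbb L_{i+1}}\circ\mathbb K_i\rangle^i\circ\widehat{\mathbb L_1}.$$ Let $\mathbb W^1_0=\epsilon$ and $\mathbb W^1_n=1\cdot\mathbb W^1_{n-1}\circ\mathbb Z_n$ for $n\ge1$. **Theorem.** For every $n\ge1$, the list $\mathbb W^1_n$ is a $1$-Gray code for $\mathcal W^1_n$, with $\mathrm{first}(\mathbb W^1_n)=1^n$ and $\mathrm{last}(\mathbb W^1_n)=(001)^\star$. -/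

import Mathlib

namespace QDecreasing

/-- Binary words; `false` is the letter 0 and `true` is the letter 1. -/
abbrev Word := List Bool

/-- The word `0^a`. -/
def zeros (a : ℕ) : Word := List.replicate a false

/-- The word `1^b`. -/
def ones (b : ℕ) : Word := List.replicate b true

/-- In the word `x 0^a 1^b y` with `a > 0`, the displayed occurrence of `0^a 1^b` cannot be
extended to a longer factor of the same form: a letter just before it would have to be 0; a letter
just after it would have to be 1, or may be anything if `b = 0`. -/
def IsMaximalFactor (x : Word) (_a b : ℕ) (y : Word) : Prop :=
  x.getLast? ≠ some false ∧ y.head? ≠ some true ∧ (b = 0 → y.head? ≠ some false)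

/-- `w` is `q`-decreasing: each of its length maximal factors `0^a 1^b` with `a > 0`
satisfies `q * a > b`. -/
def IsDecreasing (q : ℕ) (w : Word) : Prop :=
  ∀ (x y : Word) (a b : ℕ), w = x ++ zeros a ++ ones b ++ y → 0 < a →
    IsMaximalFactor x a b y → b < q * a

/-- The set of `q`-decreasing words of length `n`. -/
def decreasingWords (q n : ℕ) : Set Word :=
  {w | w.length = n ∧ IsDecreasing q w}

/-- The Hamming distance of two words of the same length. -/
def hamming (u v : Word) : ℕ :=
  (List.zip u v).countP (fun p => p.1 != p.2)

/-- `L` is a `k`-Gray code for the set `A` of words of length `n`: it lists every element of `A`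
exactly once and nothing else, and consecutive words are at Hamming distance at most `k`. -/
structure IsGrayCode (k n : ℕ) (A : Set Word) (L : List Word) : Prop where
  length_eq : ∀ w ∈ A, w.length = n
  nodup : L.Nodup
  mem_iff : ∀ w, w ∈ L ↔ w ∈ A
  chain : L.IsChain (fun u v => hamming u v ≤ k)

/-- `w · L`: the word `w` is put in front of every word of `L`. -/
def prepend (w : Word) (L : List Word) : List Word := L.map (fun u => w ++ u)

/-- `⟨L⟩^i`: the list `L` if `i` is even, its reverse if `i` is odd. -/
def flipIf (i : ℕ) (L : List Word) : List Word := if i % 2 = 0 then L else L.reverse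

/-- The concatenation `L 1 ∘ L 2 ∘ ⋯ ∘ L m`. -/
def concatUp (m : ℕ) (L : ℕ → List Word) : List Word := (List.range' 1 m).flatMap L

/-- The concatenation `L m ∘ ⋯ ∘ L 2 ∘ L 1`. -/
def concatDown (m : ℕ) (L : ℕ → List Word) : List Word := (List.range' 1 m).reverse.flatMap L

/-- `0^a 1^b`. -/
def block (a b : ℕ) : Word := zeros a ++ ones b

/-- The word `(001)^⋆` of length `n`: the prefix of length `n` of `001001001⋯`. -/
def prefix001 (n : ℕ) : Word := (List.range n).map (fun i => i % 3 == 2)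

/-- The lists `Δ_n^r` for `r = 1 mod 4`, in terms of the lists `Z k`, `k < n`. -/
def deltaOne (Z : ℕ → List Word) (n r : ℕ) : List Word :=
  if r = n - 1 then
    concatUp ((n - 4) / 2) (fun j => [block (n - 2 - j) j ++ [false, false]])
      ++ [block (n / 2) ((n - 2) / 2) ++ [false]]
      ++ (concatUp ((n - 4) / 2) (fun j => flipIf (j - 1)
          [block (n - j - 1) (j + 1), block (n - 1 - j) j ++ [false]])).reverse
      ++ [block (n - 1) 1]
  else
    concatUp ((r - 3) / 2) (fun j => prepend (block (r - 1 - j) j) (flipIf j (Z (n - r + 1))))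
      ++ (concatUp ((r - 1) / 2)
          (fun j => prepend (block (r - j) j) (flipIf j (Z (n - r))))).reverse

/-- The lists `Δ_n^r` for `r = 3 mod 4`, in terms of the lists `Z k`, `k < n`. -/
def deltaThree (Z : ℕ → List Word) (n r : ℕ) : List Word :=
  if r = 3 then
    prepend (block 2 1) (Z (n - 3))
  else if r = n - 2 then
    concatUp ((n - 5) / 2) (fun j => prepend (block (n - 3 - j) j) (flipIf (j - 1) (Z 3)))
      ++ (concatUp ((n - 3) / 2) (fun j => prepend (block (n - 2 - j) j) (Z 2))).reverse
  else if r = n - 1 then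
    concatUp ((n - 4) / 2) (fun j => prepend (block (n - 2 - j) j) (Z 2))
      ++ prepend (block (n / 2) ((n - 2) / 2)) (Z 1)
      ++ (concatUp ((n - 4) / 2) (fun j => flipIf j
          ([block (n - 1 - j) (j + 1)] ++ prepend (block (n - 1 - j) j) (Z 1)))).reverse
  else if r = n then
    concatUp ((n - 3) / 2) (fun j => [block (n - 1 - j) j ++ [false]])
      ++ (concatUp ((n - 1) / 2) (fun j => [block (n - j) j])).reverse
  else
    let a := (r - 3) / 2
    let K : ℕ → List Word := fun i => prepend (block (r - 1 - i) i) (Z (n - r + 1))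
    let L : ℕ → List Word := fun i => prepend (block (r - i) i) (Z (n - r))
    concatUp (a + 1) (fun i => (L i).take 1)
      ++ concatDown a (fun i => flipIf i ((L (i + 1)).tail ++ K i))
      ++ (L 1).tail

/-- `Δ_n^5 ∘ Δ_n^9 ∘ ⋯ ∘ Δ_n^t` for `t = 1 mod 4` (empty if `t = 1`). -/
def ascending (Z : ℕ → List Word) (n t : ℕ) : List Word :=
  concatUp ((t - 1) / 4) (fun i => deltaOne Z n (4 * i + 1))

/-- `Δ_n^t ∘ ⋯ ∘ Δ_n^7 ∘ Δ_n^3` for `t = 3 mod 4`. -/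
def descending (Z : ℕ → List Word) (n t : ℕ) : List Word :=
  concatDown ((t + 1) / 4) (fun i => deltaThree Z n (4 * i - 1))

/-- The list of index `n`, in terms of the lists `Z k`, `k < n`. -/
def zStep (Z : ℕ → List Word) (n : ℕ) : List Word :=
  if n ≤ 2 then [zeros n]
  else if n = 3 then [zeros 3, block 2 1]
  else if n % 4 = 1 then ascending Z n n ++ [zeros n] ++ descending Z n (n - 2)
  else if n % 4 = 2 then ascending Z n (n - 1) ++ [zeros n] ++ descending Z n (n - 3)
  else if n % 4 = 3 then ascending Z n (n - 2) ++ [zeros n] ++ descending Z n n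
  else ascending Z n (n - 3) ++ [block (n - 1) 1] ++ [zeros n] ++ descending Z n (n - 1)

/-- The list `Z_n`, by recursion on `n`; `zStep` consults only lists of smaller index. -/
def zList (n : ℕ) : List Word :=
  zStep (fun k => if _h : k < n then zList k else []) n
termination_by n

/-- The list `W_n`: `W_0` contains only the empty word, and `W_n = 1 · W_{n-1} ∘ Z_n`
for `n ≥ 1`. -/
def wList : ℕ → List Word
  | 0 => [[]]
  | n + 1 => prepend [true] (wList n) ++ zList (n + 1)

end QDecreasing

/-! The words of the list with index `n` are the decreasing words of length `n` that do not start
with 1; `W_n` then splits the decreasing words by their first letter.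

Contents. Such a word is `0^n` or is, in exactly one way, `0^{s-j} 1^j y` with `0 < j < s - j` and
`y` a word of the same kind of length `n - s` (`isTailWord_iff`, `block_append_inj`). Fix `s`; the
words obtained form a *layer*. Each `Δ_n^r` rearranges the layers `r - 1` and `r`, and for even `n`
the last one also takes in the layer `n`, up to the word `0^{n-1} 1`, which stands alone in `Z_n` if
4 divides `n`. Since order is irrelevant here, this is an identity in the
commutative monoid of multisets (`coe_deltaOne`, `coe_deltaThree` and their variants for
`r = n - 1`), and adding up gives `coe_zStep`.

Order. By strong induction the list of index `n` is a path, in the graph of words at Hamming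
distance at most one, from `f_n = 0 l_{n-1}` to `l_n = (001)^⋆` (`isPath_zStep`). For `r = 1 mod 4`
the list `Δ_n^r` goes from `0^{r-2} 1 l_{n-r+1}` to `0^{r-1} 1 l_{n-r}` (to `0^{n-1} 1` if
`r = n - 1`); for `r = 3 mod 4` it ends in `0^{r-1} 1 l_{n-r}` and generically starts at
`0^{r-1} 1 f_{n-r}`. The seams inside a `Δ_n^r` that join different blocks change
either `0^{a+1} 1^b y` into `0^a 1^{b+1} y` (`adj_block`) or, by `f_{m+1} = 0 l_m`,
`0^a 1^b f_{m+1}` into `0^a 1^{b+1} l_m` (`adj_block_zero`). The seams between different `Δ_n^r`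
come from `l_{m+3} = 001 l_m` and `f_{m+4} = 0001 l_m`, and in the middle a single 1 is removed to
reach `0^n` and another is set after it. -/

namespace QDecreasing

/-! ### Paths in the graph of words at Hamming distance at most one -/

/-- Two words are adjacent if they differ in at most one position. -/
def Adj (u v : Word) : Prop := hamming u v ≤ 1

theorem hamming_append_left (w u v : Word) : hamming (w ++ u) (w ++ v) = hamming u v := by
  induction w with
  | nil => rfl
  | cons a w ih => simpa [hamming] using ih

theorem hamming_self (u : Word) : hamming u u = 0 := by
  have h := hamming_append_left u [] []
  simpa [hamming] using h

theorem hamming_comm (u v : Word) : hamming u v = hamming v u := by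
  induction u generalizing v with
  | nil => simp [hamming]
  | cons a u ih =>
    cases v with
    | nil => simp [hamming]
    | cons b v =>
      have := ih v
      simp only [hamming, List.zip_cons_cons, List.countP_cons] at this ⊢
      rw [this]
      cases a <;> cases b <;> rfl

theorem Adj.symm {u v : Word} (h : Adj u v) : Adj v u := by
  unfold Adj; rw [hamming_comm]; exact h

theorem Adj.append_left {u v : Word} (w : Word) (h : Adj u v) : Adj (w ++ u) (w ++ v) := by
  unfold Adj; rw [hamming_append_left]; exact h

theorem adj_letter (p s : Word) (a b : Bool) : Adj (p ++ a :: s) (p ++ b :: s) := by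
  apply Adj.append_left
  have := hamming_self s
  simp only [Adj, hamming, List.zip_cons_cons, List.countP_cons] at this ⊢
  split_ifs <;> omega

theorem zeros_add (a b : ℕ) : zeros (a + b) = zeros a ++ zeros b :=
  List.replicate_add a b false

theorem ones_add (a b : ℕ) : ones (a + b) = ones a ++ ones b :=
  List.replicate_add a b true

/-- The last 0 of a block `0^a 1^b` may be turned into a 1. -/
theorem adj_block {a a' b b' : ℕ} (ha : a = a' + 1) (hb : b' = b + 1) (s : Word) :
    Adj (block a b ++ s) (block a' b' ++ s) := by
  subst ha hb
  have h1 : block (a' + 1) b ++ s = zeros a' ++ false :: (ones b ++ s) := by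
    simp [block, zeros_add a' 1, show zeros 1 = [false] from rfl]
  have h2 : block a' (b + 1) ++ s = zeros a' ++ true :: (ones b ++ s) := by
    rw [block, Nat.add_comm, ones_add]; simp [ones]
  rw [h1, h2]
  exact adj_letter _ _ _ _

/-- A 0 that follows a block `0^a 1^b` may be turned into a 1, which joins the block. -/
theorem adj_block_zero {a a' b b' : ℕ} (ha : a = a') (hb : b' = b + 1) (s : Word) :
    Adj (block a b ++ false :: s) (block a' b' ++ s) := by
  subst ha hb
  have h2 : block a (b + 1) ++ s = block a b ++ true :: s := by
    simp [block, ones_add b 1, show ones 1 = [true] from rfl]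
  rw [h2]
  exact adj_letter _ _ _ _

/-- `L` is a nonempty list from `u` to `v` in which consecutive words are adjacent. -/
structure IsPath (L : List Word) (u v : Word) : Prop where
  chain : L.IsChain Adj
  head : L.head? = some u
  last : L.getLast? = some v

theorem IsPath.congr {L : List Word} {u v u' v' : Word} (h : IsPath L u v) (hu : u = u')
    (hv : v = v') : IsPath L u' v' := hu ▸ hv ▸ h

theorem isPath_singleton (u : Word) : IsPath [u] u u := ⟨by simp, by simp, by simp⟩

theorem IsPath.append {L M : List Word} {u v u' v' : Word} (hL : IsPath L u v)
    (hM : IsPath M u' v') (h : Adj v u') : IsPath (L ++ M) u v' := by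
  refine ⟨?_, ?_, ?_⟩
  · rw [List.isChain_append]
    refine ⟨hL.chain, hM.chain, ?_⟩
    rw [hL.last, hM.head]
    simpa using h
  · rw [List.head?_append, hL.head]; rfl
  · rw [List.getLast?_append, hM.last]; rfl

theorem IsPath.reverse {L : List Word} {u v : Word} (h : IsPath L u v) :
    IsPath L.reverse v u := by
  refine ⟨?_, ?_, ?_⟩
  · rw [List.isChain_reverse]
    exact h.chain.imp fun _ _ => Adj.symm
  · rw [List.head?_reverse, h.last]
  · rw [List.getLast?_reverse, h.head]

theorem IsPath.prepend {L : List Word} {u v : Word} (h : IsPath L u v) (w : Word) :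
    IsPath (prepend w L) (w ++ u) (w ++ v) := by
  refine ⟨?_, ?_, ?_⟩
  · rw [QDecreasing.prepend, List.isChain_map]
    exact h.chain.imp fun _ _ => Adj.append_left w
  · simp [QDecreasing.prepend, h.head]
  · simp [QDecreasing.prepend, h.last]

theorem IsPath.flipIf {L : List Word} {u v : Word} (h : IsPath L u v) (i : ℕ) :
    IsPath (flipIf i L) (if i % 2 = 0 then u else v) (if i % 2 = 0 then v else u) := by
  unfold QDecreasing.flipIf
  split_ifs
  · exact h
  · exact h.reverse

theorem concatUp_zero (L : ℕ → List Word) : concatUp 0 L = [] := rfl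

theorem concatUp_succ (m : ℕ) (L : ℕ → List Word) :
    concatUp (m + 1) L = concatUp m L ++ L (m + 1) := by
  simp [concatUp, List.range'_1_concat, Nat.add_comm]

theorem concatDown_succ (m : ℕ) (L : ℕ → List Word) :
    concatDown (m + 1) L = L (m + 1) ++ concatDown m L := by
  simp [concatDown, List.range'_1_concat, Nat.add_comm]

theorem isPath_concatUp {m : ℕ} (hm : 1 ≤ m) {L : ℕ → List Word} (u v : ℕ → Word)
    (h : ∀ j, 1 ≤ j → j ≤ m → IsPath (L j) (u j) (v j))
    (hs : ∀ j, 1 ≤ j → j < m → Adj (v j) (u (j + 1))) :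
    IsPath (concatUp m L) (u 1) (v m) := by
  induction m, hm using Nat.le_induction with
  | base => rw [concatUp_succ, concatUp_zero]; exact h 1 le_rfl le_rfl
  | succ m hm ih =>
    rw [concatUp_succ]
    exact (ih (fun j h1 h2 => h j h1 (by omega)) (fun j h1 h2 => hs j h1 (by omega))).append
      (h _ (by omega) le_rfl) (hs m hm (by omega))

theorem isPath_concatDown {m : ℕ} (hm : 1 ≤ m) {L : ℕ → List Word} (u v : ℕ → Word)
    (h : ∀ j, 1 ≤ j → j ≤ m → IsPath (L j) (u j) (v j))
    (hs : ∀ j, 1 ≤ j → j < m → Adj (v (j + 1)) (u j)) :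
    IsPath (concatDown m L) (u m) (v 1) := by
  induction m, hm using Nat.le_induction with
  | base => rw [concatDown_succ]; simpa [concatDown] using h 1 le_rfl le_rfl
  | succ m hm ih =>
    rw [concatDown_succ]
    exact (h _ (by omega) le_rfl).append
      (ih (fun j h1 h2 => h j h1 (by omega)) (fun j h1 h2 => hs j h1 (by omega)))
      (hs m hm (by omega))

/-! ### The end words -/

/-- The first word of the list of index `n`: it is `0` followed by a prefix of `001001⋯`. -/
def firstWord : ℕ → Word
  | 0 => []
  | n + 1 => false :: prefix001 n

theorem prefix001_add_three (n : ℕ) : prefix001 (n + 3) = block 2 1 ++ prefix001 n := by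
  rw [prefix001, Nat.add_comm, List.range_add, List.map_append, List.map_map, prefix001]
  congr 1
  apply List.map_congr_left
  intro i _
  simp [Nat.add_comm 3 i]

theorem firstWord_add_four (n : ℕ) :
    firstWord (n + 4) = block 3 1 ++ prefix001 n := by
  rw [firstWord, prefix001_add_three]; rfl

theorem firstWord_eq_zeros {n : ℕ} (h : n ≤ 3) : firstWord n = zeros n := by
  interval_cases n <;> rfl

theorem prefix001_eq_zeros {n : ℕ} (h : n ≤ 2) : prefix001 n = zeros n := by
  interval_cases n <;> rfl

theorem firstWord_ne_prefix001 {n : ℕ} (h : 3 ≤ n) : firstWord n ≠ prefix001 n := by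
  obtain ⟨m, rfl⟩ := Nat.exists_eq_add_of_le' h
  rw [prefix001_add_three]
  cases m with
  | zero => decide
  | succ m => rw [firstWord_add_four]; simp [block, zeros, ones]

/-! ### The lists `Δ_n^r` as paths -/

/-- The seam between `Δ_n^r` and `Δ_n^{r+4}` for `r = 1 mod 4`, by `l_{m+3} = 001 l_m`. -/
theorem adj_ascending {a a' m m' : ℕ} (ha : a' = a + 3) (hm : m = m' + 3) :
    Adj (block a 1 ++ prefix001 m) (block a' 1 ++ prefix001 m') := by
  subst ha hm
  have h := adj_letter (zeros a) (block 2 1 ++ prefix001 m') true false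
  rw [prefix001_add_three, show block (a + 3) 1 = zeros a ++ block 3 1 by
    rw [block, zeros_add, List.append_assoc, block]]
  simpa [block, zeros, ones] using h

/-- The seam between `Δ_n^r` and `Δ_n^{r-4}` for `r = 3 mod 4`, by `f_{m+4} = 0001 l_m`. -/
theorem adj_descending {a a' m m' : ℕ} (ha : a = a' + 4) (hm : m' = m + 4) :
    Adj (block a 1 ++ prefix001 m) (block a' 1 ++ firstWord m') := by
  subst ha hm
  have h := adj_letter (zeros a') (block 3 1 ++ prefix001 m) false true
  rw [firstWord_add_four, show block (a' + 4) 1 = zeros a' ++ block 4 1 by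
    rw [block, zeros_add, List.append_assoc, block]]
  simpa [block, zeros, ones] using h

theorem adj_zeros_block {n a m : ℕ} (h : n = a + 1 + m) :
    Adj (zeros n) (block a 1 ++ zeros m) := by
  have := adj_block (a := a + 1) (b := 0) rfl rfl (zeros m)
  rwa [show block (a + 1) 0 ++ zeros m = zeros n by
    simp [h, block, ones, zeros_add]] at this

/-- Each block `0^a 1^b` is followed by a list that is traversed in alternating directions, so that
from one block to the next only the block changes. The first half ends in `0^{a+2} 1^a f_{m+1}` and
the second starts with `0^{a+2} 1^{a+1} l_m`, where `r = 2a + 3` and `m = n - r`. -/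
theorem isPath_deltaOne {Z : ℕ → List Word} {n r : ℕ}
    (hZ : ∀ k < n, IsPath (Z k) (firstWord k) (prefix001 k)) (hr : r % 4 = 1) (h5 : 5 ≤ r)
    (hn : r ≤ n) (hne : r ≠ n - 1) :
    IsPath (deltaOne Z n r) (block (r - 2) 1 ++ prefix001 (n - r + 1))
      (block (r - 1) 1 ++ prefix001 (n - r)) := by
  rw [deltaOne, if_neg hne]
  have hA := isPath_concatUp (m := (r - 3) / 2) (by omega) _ _
    (fun j _ _ => ((hZ (n - r + 1) (by omega)).flipIf j).prepend (block (r - 1 - j) j))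
    (fun j h1 h2 => by
      have : (if (j + 1) % 2 = 0 then firstWord (n - r + 1) else prefix001 (n - r + 1)) =
          if j % 2 = 0 then prefix001 (n - r + 1) else firstWord (n - r + 1) := by
        split_ifs <;> first | rfl | omega
      rw [this]
      exact adj_block (by omega) rfl _)
  have hB := isPath_concatUp (m := (r - 1) / 2) (by omega) _ _
    (fun j _ _ => ((hZ (n - r) (by omega)).flipIf j).prepend (block (r - j) j))
    (fun j h1 h2 => by
      have : (if (j + 1) % 2 = 0 then firstWord (n - r) else prefix001 (n - r)) =
          if j % 2 = 0 then prefix001 (n - r) else firstWord (n - r) := by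
        split_ifs <;> first | rfl | omega
      rw [this]
      exact adj_block (by omega) rfl _)
  refine (hA.append hB.reverse ?_).congr (by simp [Nat.sub_sub]) (by simp)
  rw [if_neg (by omega), if_pos (by omega)]
  exact adj_block_zero (by omega) (by omega) _

/-- The case `r = n - 1 = 1 mod 4`, which also lists the words `0^{n-j} 1^j`. -/
theorem isPath_deltaOne_pred {Z : ℕ → List Word} {n r : ℕ} (hr : r % 4 = 1) (h5 : 5 ≤ r)
    (hn : r = n - 1) :
    IsPath (deltaOne Z n r) (block (r - 2) 1 ++ prefix001 (n - r + 1)) (block (n - 1) 1) := by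
  rw [deltaOne, if_pos hn]
  have hA := isPath_concatUp (m := (n - 4) / 2) (by omega) _ _
    (fun j _ _ => isPath_singleton (block (n - 2 - j) j ++ [false, false]))
    (fun j h1 h2 => adj_block (by omega) rfl _)
  have hB := isPath_concatUp (m := (n - 4) / 2) (by omega) _ _
    (fun j _ _ => ((isPath_singleton (block (n - j - 1) (j + 1))).append
      (isPath_singleton (block (n - 1 - j) j ++ [false]))
      (by simpa using (adj_block_zero (by omega) rfl []).symm)).flipIf (j - 1))
    (fun j h1 h2 => by
      rcases Nat.mod_two_eq_zero_or_one j with h | h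
      · rw [if_neg (by omega), if_pos (by omega)]
        simpa using adj_block (a := n - j - 1) (a' := n - (j + 1) - 1) (by omega) rfl []
      · rw [if_pos (by omega), if_neg (by omega)]
        exact adj_block (by omega) rfl _)
  refine (((hA.append (isPath_singleton _) ?_).append hB.reverse ?_).append
    (isPath_singleton _) ?_).congr ?_ rfl
  · exact adj_block_zero (by omega) (by omega) [false]
  · rw [if_pos (by omega)]
    exact (adj_block (by omega) (by omega) _).symm
  · rw [if_pos (by omega)]
    simpa using (adj_block (a := n - 1) (a' := n - 1 - 1) (by omega) rfl []).symm
  · rw [show n - r + 1 = 2 by omega, show r - 2 = n - 2 - 1 by omega]; rfl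

/-- A path of at least two words loses its first word and starts at a neighbour of it. -/
theorem IsPath.exists_tail {L : List Word} {u v : Word} (h : IsPath L u v) (huv : u ≠ v) :
    ∃ w, Adj u w ∧ IsPath L.tail w v := by
  obtain ⟨hc, hh, hl⟩ := h
  match L with
  | [] => simp at hh
  | [a] => simp at hh hl; exact absurd (hh.symm.trans hl) huv
  | a :: b :: L =>
    simp at hh hl hc
    subst hh
    exact ⟨b, hc.1, hc.2, rfl, by simpa using hl⟩

/-- The first word of `Δ_n^r` for `r = 3 mod 4`. -/
def deltaThreeFirst (n r : ℕ) : Word :=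
  if r = 3 ∨ r ≤ n - 3 then block (r - 1) 1 ++ firstWord (n - r)
  else block (r - 2) 1 ++ firstWord (n - r + 1)

/-- The first words of the lists `L_i` are visited on the way out. On the way back the rests of these
lists are joined with the lists `K_i`; they start at the second word of the list of index `n - r`,
which is a neighbour of its first word. -/
theorem isPath_deltaThree_generic {Z : ℕ → List Word} {n r : ℕ}
    (hZ : ∀ k < n, IsPath (Z k) (firstWord k) (prefix001 k)) (hr : r % 4 = 3)
    (hr3 : r ≠ 3) (hn : r + 3 ≤ n) :
    IsPath (deltaThree Z n r) (block (r - 1) 1 ++ firstWord (n - r))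
      (block (r - 1) 1 ++ prefix001 (n - r)) := by
  rw [deltaThree, if_neg hr3, if_neg (by omega), if_neg (by omega), if_neg (by omega)]
  dsimp only
  have hL := hZ (n - r) (by omega)
  obtain ⟨g, hg, ht⟩ := hL.exists_tail (firstWord_ne_prefix001 (by omega))
  have ht' (i : ℕ) : IsPath (prepend (block (r - i) i) (Z (n - r))).tail (block (r - i) i ++ g)
      (block (r - i) i ++ prefix001 (n - r)) := by
    have := ht.prepend (block (r - i) i)
    rwa [prepend, List.map_tail] at this
  have hA := isPath_concatUp (m := (r - 3) / 2 + 1) (by omega)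
    (L := fun i => (prepend (block (r - i) i) (Z (n - r))).take 1)
    (fun i => block (r - i) i ++ firstWord (n - r)) (fun i => block (r - i) i ++ firstWord (n - r))
    (fun i _ _ => by
      have h := (hL.prepend (block (r - i) i)).head
      match hM : prepend (block (r - i) i) (Z (n - r)) with
      | [] => simp [hM] at h
      | a :: M =>
        rw [hM] at h
        simp only [List.head?_cons, Option.some.injEq] at h
        subst h
        exact isPath_singleton _)
    (fun i h1 h2 => adj_block (by omega) rfl _)
  have hB := isPath_concatDown (m := (r - 3) / 2) (by omega) _ _
    (fun i _ _ => ((ht' (i + 1)).append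
      ((hZ (n - r + 1) (by omega)).prepend (block (r - 1 - i) i))
      (adj_block_zero (by omega) rfl _).symm).flipIf i)
    (fun i h1 h2 => by
      rcases Nat.mod_two_eq_zero_or_one i with h | h
      · rw [if_neg (by omega), if_pos (by omega)]
        exact (adj_block (by omega) rfl _).symm
      · rw [if_pos (by omega), if_neg (by omega)]
        exact (adj_block (by omega) rfl _).symm)
  refine ((hA.append hB ?_).append (ht' 1) ?_).congr rfl rfl
  · rw [if_pos (by omega)]
    exact hg.append_left _
  · rw [if_neg (by omega)]
    exact (adj_block (by omega) rfl _).symm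

theorem isPath_deltaThree {Z : ℕ → List Word} {n r : ℕ}
    (hZ : ∀ k < n, IsPath (Z k) (firstWord k) (prefix001 k)) (hr : r % 4 = 3)
    (hn : r ≤ n) (h3 : 3 < n) :
    IsPath (deltaThree Z n r) (deltaThreeFirst n r) (block (r - 1) 1 ++ prefix001 (n - r)) := by
  unfold deltaThreeFirst
  by_cases hr3 : r = 3
  · subst hr3
    rw [deltaThree, if_pos rfl, if_pos (Or.inl rfl)]
    exact (hZ _ (by omega)).prepend _
  by_cases hrn : r + 3 ≤ n
  · rw [if_pos (by omega)]
    exact isPath_deltaThree_generic hZ hr hr3 hrn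
  rw [if_neg (by omega), deltaThree, if_neg hr3]
  by_cases h2 : r = n - 2
  · rw [if_pos h2]
    have hA := isPath_concatUp (m := (n - 5) / 2) (by omega) _ _
      (fun j _ _ => ((hZ 3 h3).flipIf (j - 1)).prepend (block (n - 3 - j) j))
      (fun j h1 h2 => by
        have : (if (j + 1 - 1) % 2 = 0 then firstWord 3 else prefix001 3) =
            if (j - 1) % 2 = 0 then prefix001 3 else firstWord 3 := by
          split_ifs <;> first | rfl | omega
        rw [this]
        exact adj_block (by omega) rfl _)
    have hB := isPath_concatUp (m := (n - 3) / 2) (by omega) _ _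
      (fun j _ _ => (hZ 2 (by omega)).prepend (block (n - 2 - j) j))
      (fun j h1 h2 => adj_block (a := n - 2 - j) (a' := n - 2 - (j + 1)) (by omega) rfl [false, false])
    refine (hA.append hB.reverse ?_).congr ?_ ?_
    · rw [if_neg (by omega)]
      exact adj_block_zero (by omega) (by omega) _
    · rw [show n - r + 1 = 3 by omega, show r - 2 = n - 3 - 1 by omega]; rfl
    · rw [show n - r = 2 by omega, show r - 1 = n - 2 - 1 by omega]; rfl
  rw [if_neg h2]
  by_cases h1 : r = n - 1
  · rw [if_pos h1]
    have hA := isPath_concatUp (m := (n - 4) / 2) (by omega) _ _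
      (fun j _ _ => (hZ 2 (by omega)).prepend (block (n - 2 - j) j))
      (fun j h1 h2 => adj_block (a := n - 2 - j) (a' := n - 2 - (j + 1)) (by omega) rfl [false, false])
    have hB := isPath_concatUp (m := (n - 4) / 2) (by omega) _ _
      (fun j _ _ => ((isPath_singleton (block (n - 1 - j) (j + 1))).append
        ((hZ 1 (by omega)).prepend (block (n - 1 - j) j))
        (by simpa [firstWord, prefix001] using (adj_block_zero (by omega) rfl []).symm)).flipIf j)
      (fun j h1 h2 => by
        rcases Nat.mod_two_eq_zero_or_one j with h | h
        · rw [if_pos (by omega), if_neg (by omega)]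
          exact adj_block (a := n - 1 - j) (a' := n - 1 - (j + 1)) (by omega) rfl [false]
        · rw [if_neg (by omega), if_pos (by omega)]
          simpa using adj_block (a := n - 1 - j) (a' := n - 1 - (j + 1)) (by omega) rfl [])
    refine ((hA.append ((hZ 1 (by omega)).prepend _) ?_).append hB.reverse ?_).congr ?_ ?_
    · exact adj_block_zero (by omega) (by omega) [false]
    · rw [if_pos (by omega)]
      exact (adj_block (a := n - 1 - (n - 4) / 2) (by omega) (by omega) [false]).symm
    · rw [show n - r + 1 = 2 by omega, show r - 2 = n - 2 - 1 by omega]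
    · rw [if_neg (by omega), show n - r = 1 by omega, show r - 1 = n - 1 - 1 by omega]
  rw [if_neg h1, if_pos (by omega)]
  have hA := isPath_concatUp (m := (n - 3) / 2) (by omega) _ _
    (fun j _ _ => isPath_singleton (block (n - 1 - j) j ++ [false]))
    (fun j h1 h2 => adj_block (by omega) rfl _)
  have hB := isPath_concatUp (m := (n - 1) / 2) (by omega) _ _
    (fun j _ _ => isPath_singleton (block (n - j) j))
    (fun j h1 h2 => by
      simpa using adj_block (a := n - j) (a' := n - (j + 1)) (by omega) rfl [])
  refine (hA.append hB.reverse ?_).congr ?_ ?_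
  · simpa using adj_block_zero (a := n - 1 - (n - 3) / 2) (a' := n - (n - 1) / 2)
      (b := (n - 3) / 2) (b' := (n - 1) / 2) (by omega) (by omega) []
  · rw [show n - r + 1 = 1 by omega, show r - 2 = n - 1 - 1 by omega]; rfl
  · rw [show n - r = 0 by omega, show r - 1 = n - 1 by omega]; simp [prefix001]

/-! ### The lists `Z_n` and `W_n` as paths -/

theorem isPath_ascending {Z : ℕ → List Word} {n k : ℕ}
    (hZ : ∀ k < n, IsPath (Z k) (firstWord k) (prefix001 k)) (hk : 1 ≤ k) (hn : 4 * k + 1 ≤ n) :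
    IsPath (concatUp k fun i => deltaOne Z n (4 * i + 1)) (firstWord n)
      (if 4 * k + 1 = n - 1 then block (n - 1) 1
        else block (4 * k) 1 ++ prefix001 (n - (4 * k + 1))) := by
  have h := isPath_concatUp hk (L := fun i => deltaOne Z n (4 * i + 1))
    (fun i => block (4 * i - 1) 1 ++ prefix001 (n - (4 * i + 1) + 1))
    (fun i => if 4 * i + 1 = n - 1 then block (n - 1) 1
        else block (4 * i) 1 ++ prefix001 (n - (4 * i + 1)))
    (fun i h1 h2 => by
      split_ifs with h
      · exact isPath_deltaOne_pred (by omega) (by omega) h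
      · exact isPath_deltaOne hZ (by omega) (by omega) (by omega) h)
    (fun i h1 h2 => by
      rw [if_neg (by omega)]
      exact adj_ascending (by omega) (by omega))
  refine h.congr ?_ rfl
  rw [show n - (4 * 1 + 1) + 1 = n - 4 by omega, ← firstWord_add_four]
  congr 1
  omega

theorem isPath_descending {Z : ℕ → List Word} {n k : ℕ}
    (hZ : ∀ k < n, IsPath (Z k) (firstWord k) (prefix001 k)) (hk : 1 ≤ k) (hn : 4 * k - 1 ≤ n)
    (h3 : 3 < n) :
    IsPath (concatDown k fun i => deltaThree Z n (4 * i - 1)) (deltaThreeFirst n (4 * k - 1))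
      (prefix001 n) := by
  have h := isPath_concatDown hk (L := fun i => deltaThree Z n (4 * i - 1))
    (fun i => deltaThreeFirst n (4 * i - 1))
    (fun i => block (4 * i - 1 - 1) 1 ++ prefix001 (n - (4 * i - 1)))
    (fun i h1 h2 => isPath_deltaThree hZ (by omega) (by omega) h3)
    (fun i h1 h2 => by
      rw [deltaThreeFirst, if_pos (by omega)]
      exact adj_descending (by omega) (by omega))
  refine h.congr rfl ?_
  rw [show 4 * 1 - 1 - 1 = 2 from rfl, ← prefix001_add_three]
  congr 1
  omega

theorem adj_zeros_deltaThreeFirst {n r : ℕ} (h3 : 3 ≤ r) (hr : r ≤ n) (hn : n ≤ r + 3) :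
    Adj (zeros n) (deltaThreeFirst n r) := by
  rw [deltaThreeFirst]
  split_ifs with h
  · rw [firstWord_eq_zeros (by omega)]
    exact adj_zeros_block (by omega)
  · rw [firstWord_eq_zeros (by omega)]
    exact adj_zeros_block (by omega)

theorem adj_block_prefix001_zeros {n a m : ℕ} (hm : m ≤ 2) (h : n = a + 1 + m) :
    Adj (block a 1 ++ prefix001 m) (zeros n) := by
  rw [prefix001_eq_zeros hm]
  exact (adj_zeros_block h).symm

theorem adj_block_one_zeros {n : ℕ} (h : 1 ≤ n) : Adj (block (n - 1) 1) (zeros n) := by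
  have := adj_zeros_block (n := n) (a := n - 1) (m := 0) (by omega)
  simpa [zeros] using this.symm

theorem isPath_zStep {Z : ℕ → List Word} {n : ℕ}
    (hZ : ∀ k < n, IsPath (Z k) (firstWord k) (prefix001 k)) :
    IsPath (zStep Z n) (firstWord n) (prefix001 n) := by
  rw [zStep]
  by_cases h2 : n ≤ 2
  · rw [if_pos h2]
    exact (isPath_singleton _).congr (firstWord_eq_zeros (by omega)).symm
      (prefix001_eq_zeros h2).symm
  rw [if_neg h2]
  by_cases h3 : n = 3
  · subst h3
    exact ⟨by simp [Adj, hamming, zeros, block, ones], rfl, rfl⟩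
  rw [if_neg h3]
  have hz := isPath_singleton (zeros n)
  by_cases h41 : n % 4 = 1
  · rw [if_pos h41]
    refine ((isPath_ascending hZ (by omega) (by omega)).append hz ?_).append
      (isPath_descending hZ (by omega) (by omega) (by omega))
      (adj_zeros_deltaThreeFirst (by omega) (by omega) (by omega))
    rw [if_neg (by omega)]
    exact adj_block_prefix001_zeros (by omega) (by omega)
  rw [if_neg h41]
  by_cases h42 : n % 4 = 2
  · rw [if_pos h42]
    refine ((isPath_ascending hZ (by omega) (by omega)).append hz ?_).append
      (isPath_descending hZ (by omega) (by omega) (by omega))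
      (adj_zeros_deltaThreeFirst (by omega) (by omega) (by omega))
    rw [if_pos (by omega)]
    exact adj_block_one_zeros (by omega)
  rw [if_neg h42]
  by_cases h43 : n % 4 = 3
  · rw [if_pos h43]
    refine ((isPath_ascending hZ (by omega) (by omega)).append hz ?_).append
      (isPath_descending hZ (by omega) (by omega) (by omega))
      (adj_zeros_deltaThreeFirst (by omega) (by omega) (by omega))
    rw [if_neg (by omega)]
    exact adj_block_prefix001_zeros (by omega) (by omega)
  rw [if_neg h43]
  have hb := (isPath_singleton (block (n - 1) 1)).append hz
    (adj_block_one_zeros (by omega))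
  have hd := isPath_descending (k := (n - 1 + 1) / 4) hZ (by omega) (by omega) (by omega)
  have ha := adj_zeros_deltaThreeFirst (n := n) (r := 4 * ((n - 1 + 1) / 4) - 1)
    (by omega) (by omega) (by omega)
  by_cases h4 : n = 4
  · subst h4
    exact hb.append hd ha
  · rw [List.append_assoc (ascending _ _ _)]
    refine ((isPath_ascending hZ (by omega) (by omega)).append hb ?_).append hd ha
    rw [if_neg (by omega), show n - (4 * ((n - 3 - 1) / 4) + 1) = 3 by omega,
      show (4 * ((n - 3 - 1) / 4)) = n - 4 by omega]
    have h := adj_ascending (a := n - 4) (a' := n - 1) (m := 3) (m' := 0) (by omega) rfl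
    simpa [prefix001] using h

/-- For every `n` the list of index `n` is a path from `0(001)^⋆` to `(001)^⋆`. -/
theorem isPath_zList (n : ℕ) : IsPath (zList n) (firstWord n) (prefix001 n) := by
  induction n using Nat.strong_induction_on with
  | _ n ih =>
    rw [zList]
    refine isPath_zStep fun k hk => ?_
    rw [dif_pos hk]
    exact ih k hk

theorem isPath_wList (n : ℕ) : IsPath (wList n) (ones n) (prefix001 n) := by
  induction n with
  | zero => exact isPath_singleton []
  | succ n ih =>
    exact (ih.prepend [true]).append (isPath_zList (n + 1)) (adj_letter [] _ _ _)

/-! ### Contents of the lists as multisets -/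

theorem coe_flipIf (i : ℕ) (L : List Word) : (flipIf i L : Multiset Word) = L := by
  unfold flipIf
  split_ifs
  · rfl
  · exact Multiset.coe_reverse L

theorem coe_prepend (w : Word) (L : List Word) :
    (prepend w L : Multiset Word) = (L : Multiset Word).map fun u => w ++ u := rfl

theorem coe_concatUp (m : ℕ) (L : ℕ → List Word) :
    (concatUp m L : Multiset Word) = ∑ j ∈ Finset.Icc 1 m, (L j : Multiset Word) := by
  induction m with
  | zero => rfl
  | succ m ih =>
    rw [concatUp_succ, Finset.sum_Icc_succ_top (by omega), ← ih, Multiset.coe_add]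

theorem coe_concatDown (m : ℕ) (L : ℕ → List Word) :
    (concatDown m L : Multiset Word) = ∑ j ∈ Finset.Icc 1 m, (L j : Multiset Word) := by
  induction m with
  | zero => rfl
  | succ m ih =>
    rw [concatDown_succ, Finset.sum_Icc_succ_top (by omega), ← ih, Multiset.coe_add,
      Multiset.coe_eq_coe]
    exact List.perm_append_comm

/-- The words `0^{s-j} 1^j u` of length `n` with `0 < j < s - j` and `u` in the list `Z (n - s)`:
those that start with a block `0^a 1^b` of length `s`. -/
def layer (Z : ℕ → List Word) (n s : ℕ) : Multiset Word :=
  ∑ j ∈ Finset.Icc 1 ((s - 1) / 2), (prepend (block (s - j) j) (Z (n - s)) : Multiset Word)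

theorem coe_deltaOne {Z : ℕ → List Word} {n r : ℕ} (hr : r % 4 = 1) (h5 : 5 ≤ r)
    (hn : r ≤ n) (hne : r ≠ n - 1) :
    (deltaOne Z n r : Multiset Word) = layer Z n (r - 1) + layer Z n r := by
  rw [deltaOne, if_neg hne, ← Multiset.coe_add, Multiset.coe_reverse, coe_concatUp, coe_concatUp,
    layer, layer, show (r - 1 - 1) / 2 = (r - 3) / 2 by omega,
    show n - (r - 1) = n - r + 1 by omega]
  simp only [coe_prepend, coe_flipIf]

theorem sum_Icc_succ_bot {M : Type*} [AddCommMonoid M] (m : ℕ) (f : ℕ → M) :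
    ∑ j ∈ Finset.Icc 1 (m + 1), f j = f 1 + ∑ j ∈ Finset.Icc 1 m, f (j + 1) := by
  induction m with
  | zero => simp
  | succ m ih =>
    rw [Finset.sum_Icc_succ_top (by omega), ih, Finset.sum_Icc_succ_top (by omega), add_assoc]

/-- The alternating lists of pairs `0^{n-1-j} 1^{j+1}`, `0^{n-1-j} 1^j 0` that occur for
`r = n - 1` hold the words of the last two layers except `0^{n-1} 1` and `0^{n/2} 1^{(n-2)/2} 0`. -/
theorem layer_last_two {Z : ℕ → List Word} {n : ℕ} (hZ0 : Z 0 = [[]]) (hZ1 : Z 1 = [[false]])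
    (hn : n % 2 = 0) (h4 : 4 ≤ n) :
    layer Z n (n - 1) + layer Z n n =
      {block (n - 1) 1} + ({block (n / 2) ((n - 2) / 2) ++ [false]} +
        ∑ j ∈ Finset.Icc 1 ((n - 4) / 2),
          ({block (n - 1 - j) (j + 1)} + {block (n - 1 - j) j ++ [false]} : Multiset Word)) := by
  rw [layer, layer, show n - (n - 1) = 1 by omega, Nat.sub_self, hZ0, hZ1,
    show (n - 1 - 1) / 2 = (n - 4) / 2 + 1 by omega, show (n - 1) / 2 = (n - 4) / 2 + 1 by omega,
    sum_Icc_succ_bot _ fun j => (prepend (block (n - j) j) [[]] : Multiset Word),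
    Finset.sum_Icc_succ_top (by omega), Finset.sum_add_distrib,
    show n - 1 - ((n - 4) / 2 + 1) = n / 2 by omega, show (n - 4) / 2 + 1 = (n - 2) / 2 by omega]
  simp only [prepend, List.map_cons, List.map_nil, List.append_nil, Multiset.coe_singleton,
    show ∀ j, block (n - (j + 1)) (j + 1) = block (n - 1 - j) (j + 1) from
      fun j => by rw [Nat.sub_sub, Nat.add_comm 1 j]]
  abel

/-- For `r = n - 1 = 1 mod 4` the list `Δ_n^r` also takes in the layer `n`. -/
theorem coe_deltaOne_pred {Z : ℕ → List Word} {n r : ℕ} (hZ0 : Z 0 = [[]])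
    (hZ1 : Z 1 = [[false]]) (hZ2 : Z 2 = [[false, false]]) (hr : r % 4 = 1) (h5 : 5 ≤ r)
    (hn : r = n - 1) :
    (deltaOne Z n r : Multiset Word) = layer Z n (r - 1) + layer Z n r + layer Z n n := by
  rw [add_assoc, hn, layer_last_two hZ0 hZ1 (by omega) (by omega), deltaOne, if_pos rfl,
    layer, show n - (n - 1 - 1) = 2 by omega, hZ2,
    show (n - 1 - 1 - 1) / 2 = (n - 4) / 2 by omega, show n - 1 - 1 = n - 2 by omega]
  have hpair (j : ℕ) : (flipIf (j - 1) [block (n - j - 1) (j + 1), block (n - 1 - j) j ++ [false]] :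
      Multiset Word) = {block (n - 1 - j) (j + 1)} + {block (n - 1 - j) j ++ [false]} := by
    rw [coe_flipIf, show n - j - 1 = n - 1 - j by omega]
    rfl
  simp only [← Multiset.coe_add, Multiset.coe_reverse, coe_concatUp, hpair,
    Multiset.coe_singleton, prepend, List.map_cons, List.map_nil]
  abel

theorem coe_deltaThree {Z : ℕ → List Word} {n r : ℕ} (hZ0 : Z 0 = [[]])
    (hZ1 : Z 1 = [[false]]) (hr : r % 4 = 3) (hn : r ≤ n) (hne : r ≠ n - 1) (h3 : 3 < n) :
    (deltaThree Z n r : Multiset Word) = layer Z n (r - 1) + layer Z n r := by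
  by_cases hr3 : r = 3
  · subst hr3
    simp [deltaThree, layer]
  rw [deltaThree, if_neg hr3]
  by_cases h2 : r = n - 2
  · subst h2
    rw [if_pos rfl, ← Multiset.coe_add, Multiset.coe_reverse, coe_concatUp, coe_concatUp,
      layer, layer, show (n - 2 - 1 - 1) / 2 = (n - 5) / 2 by omega,
      show (n - 2 - 1) / 2 = (n - 3) / 2 by omega,
      show n - (n - 2 - 1) = 3 by omega, show n - (n - 2) = 2 by omega]
    simp only [coe_prepend, coe_flipIf, Nat.sub_sub, Nat.reduceAdd]
  rw [if_neg h2, if_neg hne]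
  by_cases h0 : r = n
  · subst h0
    rw [if_pos rfl, ← Multiset.coe_add, Multiset.coe_reverse, coe_concatUp, coe_concatUp,
      layer, layer, show (r - 1 - 1) / 2 = (r - 3) / 2 by omega,
      show r - (r - 1) = 1 by omega, Nat.sub_self, hZ0, hZ1]
    simp [prepend]
  rw [if_neg h0]
  dsimp only
  have hLK : ∀ i, ((prepend (block (r - i) i) (Z (n - r))).take 1 : Multiset Word) +
      ((prepend (block (r - i) i) (Z (n - r))).tail : Multiset Word) =
      (prepend (block (r - i) i) (Z (n - r)) : Multiset Word) := by
    intro i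
    rw [Multiset.coe_add, ← List.drop_one, List.take_append_drop]
  rw [layer, layer, show (r - 1 - 1) / 2 = (r - 3) / 2 by omega,
    show (r - 1) / 2 = (r - 3) / 2 + 1 by omega, show n - (r - 1) = n - r + 1 by omega,
    ← Finset.sum_congr rfl (fun i _ => hLK i), Finset.sum_add_distrib,
    sum_Icc_succ_bot _ fun i => ((prepend (block (r - i) i) (Z (n - r))).tail : Multiset Word)]
  simp only [← Multiset.coe_add, coe_concatUp, coe_concatDown, coe_flipIf,
    Finset.sum_add_distrib]
  abel

/-- For `r = n - 1 = 3 mod 4` the word `0^{n-1} 1` of the layer `n` is not in `Δ_n^r`. -/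
theorem coe_deltaThree_pred {Z : ℕ → List Word} {n r : ℕ} (hZ0 : Z 0 = [[]])
    (hZ1 : Z 1 = [[false]]) (hr : r % 4 = 3) (hn : r = n - 1) :
    {block (n - 1) 1} + (deltaThree Z n r : Multiset Word) =
      layer Z n (r - 1) + layer Z n r + layer Z n n := by
  rw [add_assoc, hn, layer_last_two hZ0 hZ1 (by omega) (by omega), deltaThree]
  by_cases hr3 : n - 1 = 3
  · obtain rfl : n = 4 := by omega
    simp [layer, prepend, hZ1]
  rw [if_neg hr3, if_neg (by omega), if_pos rfl, layer, show n - (n - 1 - 1) = 2 by omega,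
    show (n - 1 - 1 - 1) / 2 = (n - 4) / 2 by omega, hZ1]
  simp only [← Multiset.coe_add, Multiset.coe_reverse, coe_concatUp, coe_flipIf,
    Multiset.coe_singleton, coe_prepend, Multiset.map_singleton, Nat.sub_sub, Nat.reduceAdd]
  abel

/-- The lists `Δ_n^r` with odd `r` from 3 to `4k + 1` together hold the layers up to `4k + 1`. The
layer 2 is empty and is included so that the ranges start in the same way for `k = 0`. -/
theorem sum_layers {Z : ℕ → List Word} {n k : ℕ} (hZ0 : Z 0 = [[]]) (hZ1 : Z 1 = [[false]])
    (h3 : 3 < n) (hk : 4 * k + 1 ≤ n) (hne : 4 * k + 1 ≠ n - 1) :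
    (concatUp k (fun i => deltaOne Z n (4 * i + 1)) : Multiset Word) +
      (concatDown k (fun i => deltaThree Z n (4 * i - 1)) : Multiset Word) =
      ∑ s ∈ Finset.Icc 2 (4 * k + 1), layer Z n s := by
  rw [coe_concatUp, coe_concatDown]
  induction k with
  | zero => rfl
  | succ k ih =>
    rw [Finset.sum_Icc_succ_top (by omega), Finset.sum_Icc_succ_top (by omega),
      coe_deltaOne (by omega) (by omega) (by omega) hne,
      coe_deltaThree hZ0 hZ1 (by omega) (by omega) (by omega) h3,
      show 4 * (k + 1) + 1 = 4 * k + 1 + 1 + 1 + 1 + 1 by ring,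
      Finset.sum_Icc_succ_top (by omega), Finset.sum_Icc_succ_top (by omega),
      Finset.sum_Icc_succ_top (by omega), Finset.sum_Icc_succ_top (by omega),
      ← ih (by omega) (by omega), show 4 * (k + 1) - 1 - 1 = 4 * k + 1 + 1 by omega,
      show 4 * (k + 1) - 1 = 4 * k + 1 + 1 + 1 by omega, Nat.add_sub_cancel]
    abel

/-- The list of index `n` holds `0^n` and every layer, each exactly once. -/
theorem coe_zStep {Z : ℕ → List Word} {n : ℕ} (hZ : ∀ k < n, k ≤ 2 → Z k = [zeros k]) :
    (zStep Z n : Multiset Word) = {zeros n} + ∑ s ∈ Finset.Icc 2 n, layer Z n s := by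
  by_cases h2 : n ≤ 2
  · interval_cases n <;> simp [zStep, layer]
  have hZ0 : Z 0 = [[]] := hZ 0 (by omega) (by omega)
  have hZ1 : Z 1 = [[false]] := hZ 1 (by omega) (by omega)
  have hZ2 : Z 2 = [[false, false]] := hZ 2 (by omega) le_rfl
  by_cases h3 : n = 3
  · subst h3
    simp only [zStep, layer, show Finset.Icc 2 3 = {2, 3} from rfl]
    simp [hZ0, prepend]
    rfl
  rw [zStep, if_neg h2, if_neg h3]
  obtain ⟨k, hk⟩ : ∃ k, n = 4 * k + 1 ∨ n = 4 * (k + 1) + 2 ∨ n = 4 * k + 3 ∨ n = 4 * k + 4 :=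
    ⟨(n - 3) / 4 + if n % 4 = 1 then 1 else 0, by split_ifs <;> omega⟩
  rcases hk with rfl | rfl | rfl | rfl
  · rw [if_pos (by omega), ← sum_layers hZ0 hZ1 (by omega) le_rfl (by omega),
      ascending, descending, show (4 * k + 1 - 1) / 4 = k by omega,
      show (4 * k + 1 - 2 + 1) / 4 = k by omega]
    simp only [← Multiset.coe_add, Multiset.coe_singleton]
    abel
  · have hs : ∑ s ∈ Finset.Icc 2 (4 * (k + 1) + 2), layer Z (4 * (k + 1) + 2) s =
        ∑ s ∈ Finset.Icc 2 (4 * k + 1), layer Z (4 * (k + 1) + 2) s +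
          layer Z (4 * (k + 1) + 2) (4 * (k + 1) - 1 - 1) +
          layer Z (4 * (k + 1) + 2) (4 * (k + 1) - 1) +
          layer Z (4 * (k + 1) + 2) (4 * (k + 1) + 1 - 1) +
          layer Z (4 * (k + 1) + 2) (4 * (k + 1) + 1) +
          layer Z (4 * (k + 1) + 2) (4 * (k + 1) + 2) := by
      rw [show 4 * (k + 1) + 2 = 4 * k + 1 + 1 + 1 + 1 + 1 + 1 from rfl]
      iterate 5 rw [Finset.sum_Icc_succ_top (by omega)]
      rfl
    rw [if_neg (by omega), if_pos (by omega), ascending, descending,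
      show (4 * (k + 1) + 2 - 1 - 1) / 4 = k + 1 by omega,
      show (4 * (k + 1) + 2 - 3 + 1) / 4 = k + 1 by omega, concatUp_succ, concatDown_succ,
      hs, ← sum_layers hZ0 hZ1 (by omega) (by omega) (by omega)]
    simp only [← Multiset.coe_add, Multiset.coe_singleton]
    rw [coe_deltaOne_pred hZ0 hZ1 hZ2 (by omega) (by omega) (by omega),
      coe_deltaThree hZ0 hZ1 (by omega) (by omega) (by omega) (by omega)]
    abel
  · rw [if_neg (by omega), if_neg (by omega), if_pos (by omega), ascending, descending,
      show (4 * k + 3 - 2 - 1) / 4 = k by omega,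
      show (4 * k + 3 + 1) / 4 = k + 1 by omega, concatDown_succ,
      Finset.sum_Icc_succ_top (by omega), Finset.sum_Icc_succ_top (by omega),
      ← sum_layers hZ0 hZ1 (by omega) (by omega) (by omega)]
    simp only [← Multiset.coe_add, Multiset.coe_singleton]
    rw [coe_deltaThree hZ0 hZ1 (by omega) (by omega) (by omega) (by omega),
      show 4 * (k + 1) - 1 - 1 = 4 * k + 2 by omega, show 4 * (k + 1) - 1 = 4 * k + 3 by omega]
    abel
  · have hs : ∑ s ∈ Finset.Icc 2 (4 * k + 4), layer Z (4 * k + 4) s =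
        ∑ s ∈ Finset.Icc 2 (4 * k + 1), layer Z (4 * k + 4) s +
          (layer Z (4 * k + 4) (4 * (k + 1) - 1 - 1) + layer Z (4 * k + 4) (4 * (k + 1) - 1) +
            layer Z (4 * k + 4) (4 * k + 4)) := by
      rw [show 4 * k + 4 = 4 * k + 1 + 1 + 1 + 1 from rfl, ← add_assoc, ← add_assoc]
      iterate 3 rw [Finset.sum_Icc_succ_top (by omega)]
      rfl
    rw [if_neg (by omega), if_neg (by omega), if_neg (by omega), ascending, descending,
      show (4 * k + 4 - 3 - 1) / 4 = k by omega,
      show (4 * k + 4 - 1 + 1) / 4 = k + 1 by omega, concatDown_succ, hs,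
      ← sum_layers hZ0 hZ1 (by omega) (by omega) (by omega),
      ← coe_deltaThree_pred hZ0 hZ1 (by omega) (by omega)]
    simp only [← Multiset.coe_add, Multiset.coe_singleton]
    abel

/-! ### Decreasing words -/

theorem replicate_append_inj {c : Bool} {a a' : ℕ} {w w' : Word} (hw : w.head? ≠ some c)
    (hw' : w'.head? ≠ some c) (h : List.replicate a c ++ w = List.replicate a' c ++ w') :
    a = a' ∧ w = w' := by
  induction a generalizing a' with
  | zero =>
    cases a' with
    | zero => exact ⟨rfl, h⟩
    | succ a' =>
      simp only [List.replicate_zero, List.nil_append] at h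
      subst h
      simp [List.replicate_succ] at hw
  | succ a ih =>
    cases a' with
    | zero =>
      simp only [List.replicate_zero, List.nil_append] at h
      subst h
      simp [List.replicate_succ] at hw'
    | succ a' =>
      simp only [List.replicate_succ, List.cons_append, List.cons.injEq, true_and] at h
      exact ⟨congrArg (· + 1) (ih h).1, (ih h).2⟩

theorem exists_replicate_append (c : Bool) (w : Word) :
    ∃ a y, w = List.replicate a c ++ y ∧ y.head? ≠ some c := by
  induction w with
  | nil => exact ⟨0, [], rfl, by simp⟩
  | cons d w ih =>
    by_cases hd : d = c
    · obtain ⟨a, y, rfl, hy⟩ := ih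
      exact ⟨a + 1, y, by simp [List.replicate_succ, hd], hy⟩
    · exact ⟨0, d :: w, rfl, by simpa using hd⟩

theorem head?_ones_append {b : ℕ} (hb : 0 < b) (y : Word) :
    (ones b ++ y).head? ≠ some false := by
  obtain ⟨b, rfl⟩ := Nat.exists_eq_succ_of_ne_zero hb.ne'
  simp [ones, List.replicate_succ]

theorem block_append_inj {a a' b b' : ℕ} {y y' : Word} (hb : 0 < b) (hb' : 0 < b')
    (hy : y.head? ≠ some true) (hy' : y'.head? ≠ some true)
    (h : block a b ++ y = block a' b' ++ y') : a = a' ∧ b = b' ∧ y = y' := by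
  rw [block, block, List.append_assoc, List.append_assoc] at h
  obtain ⟨rfl, h'⟩ := replicate_append_inj (head?_ones_append hb y) (head?_ones_append hb' y') h
  exact ⟨rfl, replicate_append_inj hy hy' h'⟩

theorem isDecreasing_cons_true {q : ℕ} {w : Word} :
    IsDecreasing q (true :: w) ↔ IsDecreasing q w := by
  constructor
  · intro h x y a b hw ha hm
    refine h (true :: x) y a b (by simp [hw]) ha ⟨?_, hm.2⟩
    cases x with
    | nil => simp
    | cons c x => simpa [List.getLast?_cons_cons] using hm.1
  · intro h x y a b hw ha hm
    cases x with
    | nil =>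
      obtain ⟨a, rfl⟩ := Nat.exists_eq_succ_of_ne_zero ha.ne'
      simp [zeros, List.replicate_succ] at hw
    | cons c x =>
      simp only [List.cons_append, List.cons.injEq] at hw
      refine h x y a b hw.2 ha ⟨?_, hm.2⟩
      cases x with
      | nil => simp
      | cons d x => simpa [List.getLast?_cons_cons] using hm.1

theorem isDecreasing_ones_append {q b : ℕ} {w : Word} :
    IsDecreasing q (ones b ++ w) ↔ IsDecreasing q w := by
  induction b with
  | zero => rfl
  | succ b ih =>
    rw [← ih]
    exact isDecreasing_cons_true

/-- A word that starts with a maximal run of 0s is decreasing if and only if the maximal factor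
at its start satisfies the condition and the word after that run is decreasing. -/
theorem isDecreasing_zeros_append {q a b : ℕ} {y : Word} (ha : 0 < a) (hy : y.head? ≠ some true)
    (hb : b = 0 → y.head? ≠ some false) :
    IsDecreasing q (zeros a ++ (ones b ++ y)) ↔ b < q * a ∧ IsDecreasing q (ones b ++ y) := by
  have hw : (ones b ++ y).head? ≠ some false := by
    rcases Nat.eq_zero_or_pos b with h0 | h0
    · subst h0; exact hb rfl
    · exact head?_ones_append h0 y
  constructor
  · intro h
    refine ⟨h [] y a b (by simp) ha ⟨by simp, hy, hb⟩, ?_⟩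
    intro x y' a' b' he ha' hm
    refine h (zeros a ++ x) y' a' b' (by simp [he]) ha' ⟨?_, hm.2⟩
    cases x with
    | nil =>
      -- a factor that starts with 0 cannot start right after the maximal run
      obtain ⟨a', rfl⟩ := Nat.exists_eq_succ_of_ne_zero ha'.ne'
      rw [he] at hw
      simp [zeros, List.replicate_succ] at hw
    | cons c x =>
      have := hm.1
      rwa [List.getLast?_append_of_ne_nil _ (by simp)]
  · rintro ⟨hlt, h⟩ x y' a' b' he ha' hm
    have hw' : (ones b' ++ y').head? ≠ some false := by
      rcases Nat.eq_zero_or_pos b' with h0 | h0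
      · subst h0; exact hm.2.2 rfl
      · exact head?_ones_append h0 y'
    by_cases hx : x = []
    · subst hx
      rw [List.nil_append, List.append_assoc] at he
      obtain ⟨rfl, he'⟩ := replicate_append_inj hw hw' he
      obtain ⟨rfl, -⟩ := replicate_append_inj hy hm.2.1 he'
      exact hlt
    -- a nonempty run of 0s in front of the factor would allow an extension
    have hrun : ∀ c, 0 < c → x ≠ zeros c := by
      rintro c hc rfl
      have := hm.1
      simp [zeros, List.getLast?_replicate, hc.ne'] at this
    rw [List.append_assoc, List.append_assoc, List.append_eq_append_iff] at he
    rcases he with ⟨s, hs, he⟩ | ⟨s, hs, -⟩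
    · have hs0 : s ≠ [] := by
        rintro rfl
        exact hrun a ha (by simpa using hs)
      refine h s y' a' b' (by simp [he]) ha' ⟨?_, hm.2⟩
      have := hm.1
      rwa [hs, List.getLast?_append_of_ne_nil _ hs0] at this
    · have hp : x <+: List.replicate a false := ⟨s, hs.symm⟩
      have := List.prefix_replicate_iff.1 hp
      exact absurd this.2 (hrun _ (List.length_pos_iff.2 hx))

theorem isDecreasing_block_append {q a b : ℕ} {y : Word} (ha : 0 < a) (hb : 0 < b)
    (hy : y.head? ≠ some true) :
    IsDecreasing q (block a b ++ y) ↔ b < q * a ∧ IsDecreasing q y := by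
  rw [block, List.append_assoc, isDecreasing_zeros_append ha hy (fun h => absurd h hb.ne'),
    isDecreasing_ones_append]

theorem isDecreasing_nil (q : ℕ) : IsDecreasing q [] := by
  intro x y a b he ha
  have := congrArg List.length he
  simp [zeros] at this
  omega

theorem isDecreasing_zeros {q : ℕ} (hq : 0 < q) (n : ℕ) : IsDecreasing q (zeros n) := by
  rcases Nat.eq_zero_or_pos n with rfl | hn
  · exact isDecreasing_nil q
  · have := isDecreasing_zeros_append (q := q) (b := 0) (y := []) hn (by simp) (by simp)
    simpa [ones, isDecreasing_nil, hq, hn] using this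

/-! ### The words in the lists -/

/-- `w` is a decreasing word of length `n` that does not start with 1; these are the words of the
list of index `n`. -/
def IsTailWord (n : ℕ) (w : Word) : Prop :=
  w.length = n ∧ IsDecreasing 1 w ∧ w.head? ≠ some true

theorem length_block (a b : ℕ) : (block a b).length = a + b := by simp [block, zeros, ones]

theorem head?_block_append {a : ℕ} (ha : 0 < a) (b : ℕ) (y : Word) :
    (block a b ++ y).head? ≠ some true := by
  obtain ⟨a, rfl⟩ := Nat.exists_eq_succ_of_ne_zero ha.ne'
  simp [block, zeros, List.replicate_succ]

/-- A decreasing word that does not start with 1 is `0^n`, or splits into its first block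
`0^{s-j} 1^j` and a shorter word of the same kind. -/
theorem isTailWord_iff {n : ℕ} {w : Word} :
    IsTailWord n w ↔ w = zeros n ∨ ∃ s ∈ Finset.Icc 2 n, ∃ j ∈ Finset.Icc 1 ((s - 1) / 2),
      ∃ y, IsTailWord (n - s) y ∧ block (s - j) j ++ y = w := by
  constructor
  · rintro ⟨hl, hd, hh⟩
    obtain ⟨a, w, rfl, hw⟩ := exists_replicate_append false w
    obtain ⟨b, y, rfl, hy⟩ := exists_replicate_append true w
    change IsDecreasing 1 (zeros a ++ (ones b ++ y)) at hd
    rcases Nat.eq_zero_or_pos b with rfl | hb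
    · obtain rfl : y = [] := by
        cases y with
        | nil => rfl
        | cons c y => cases c <;> simp_all
      left
      simp at hl
      subst hl
      simp [zeros]
    have ha : 0 < a := by
      rcases Nat.eq_zero_or_pos a with rfl | ha
      · obtain ⟨b, rfl⟩ := Nat.exists_eq_succ_of_ne_zero hb.ne'
        simp [List.replicate_succ] at hh
      · exact ha
    obtain ⟨hlt, hd⟩ := (isDecreasing_zeros_append ha hy (fun h => absurd h hb.ne')).1 hd
    rw [isDecreasing_ones_append] at hd
    simp at hl
    right
    refine ⟨a + b, Finset.mem_Icc.2 ⟨by omega, by omega⟩, b, Finset.mem_Icc.2 ⟨hb, by omega⟩, y,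
      ⟨by omega, hd, hy⟩, ?_⟩
    simp [block, zeros, ones]
  · rintro (rfl | ⟨s, hs, j, hj, y, ⟨hl, hd, hh⟩, rfl⟩)
    · refine ⟨by simp [zeros], isDecreasing_zeros one_pos n, ?_⟩
      cases n <;> simp [zeros, List.replicate_succ]
    · rw [Finset.mem_Icc] at hs hj
      refine ⟨by rw [List.length_append, length_block, hl]; omega, ?_,
        head?_block_append (by omega) _ _⟩
      rw [isDecreasing_block_append (by omega) (by omega) hh]
      exact ⟨by omega, hd⟩

theorem nodup_finset_sum {ι : Type*} {s : Finset ι} {f : ι → Multiset Word}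
    (hf : ∀ i ∈ s, (f i).Nodup)
    (hd : ∀ i ∈ s, ∀ j ∈ s, ∀ w, w ∈ f i → w ∈ f j → i = j) : (∑ i ∈ s, f i).Nodup := by
  classical
  induction s using Finset.induction_on with
  | empty => simp
  | insert i s hi ih =>
    rw [Finset.sum_insert hi, Multiset.nodup_add]
    refine ⟨hf i (by simp), ih (fun j hj => hf j (by simp [hj]))
      (fun j hj k hk => hd j (by simp [hj]) k (by simp [hk])), ?_⟩
    rw [Multiset.disjoint_left]
    intro w hw hw'
    obtain ⟨j, hj, hwj⟩ := Multiset.mem_sum.1 hw'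
    exact hi (hd i (by simp) j (by simp [hj]) w hw hwj ▸ hj)

theorem mem_layer {Z : ℕ → List Word} {n s : ℕ} {w : Word} :
    w ∈ layer Z n s ↔ ∃ j ∈ Finset.Icc 1 ((s - 1) / 2), ∃ y ∈ Z (n - s),
      block (s - j) j ++ y = w := by
  simp [layer, Multiset.mem_sum, prepend]

theorem nodup_layers {Z : ℕ → List Word} {n : ℕ}
    (hZ : ∀ k < n, (Z k).Nodup ∧ ∀ w, w ∈ Z k ↔ IsTailWord k w) :
    ({zeros n} + ∑ s ∈ Finset.Icc 2 n, layer Z n s).Nodup := by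
  rw [Multiset.nodup_add]
  refine ⟨Multiset.nodup_singleton _, nodup_finset_sum ?_ ?_, ?_⟩
  · intro s hs
    rw [Finset.mem_Icc] at hs
    refine nodup_finset_sum ?_ ?_
    · intro j _
      rw [coe_prepend]
      exact Multiset.Nodup.map (fun u v h => List.append_cancel_left h)
        (Multiset.coe_nodup.2 (hZ (n - s) (by omega)).1)
    · intro i hi j hj w hwi hwj
      rw [Finset.mem_Icc] at hi hj
      simp only [prepend, Multiset.mem_coe, List.mem_map] at hwi hwj
      obtain ⟨y, hy, rfl⟩ := hwi
      obtain ⟨y', hy', h⟩ := hwj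
      rw [(hZ (n - s) (by omega)).2] at hy hy'
      exact (block_append_inj (by omega) (by omega) hy.2.2 hy'.2.2 h.symm).2.1
  · intro s hs t ht w hws hwt
    rw [Finset.mem_Icc] at hs ht
    obtain ⟨i, hi, y, hy, rfl⟩ := mem_layer.1 hws
    obtain ⟨j, hj, y', hy', h⟩ := mem_layer.1 hwt
    rw [Finset.mem_Icc] at hi hj
    rw [(hZ _ (by omega)).2] at hy hy'
    have := block_append_inj (by omega) (by omega) hy.2.2 hy'.2.2 h.symm
    omega
  · rw [Multiset.disjoint_left]
    intro w hw hw'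
    rw [Multiset.mem_singleton] at hw
    obtain ⟨s, -, hws⟩ := Multiset.mem_sum.1 hw'
    obtain ⟨j, hj, y, -, rfl⟩ := mem_layer.1 hws
    rw [Finset.mem_Icc] at hj
    have : true ∈ zeros n := by
      rw [← hw]
      simp [block, ones]
      omega
    simp [zeros] at this

/-- The list of index `n` holds exactly the decreasing words of length `n` that do not start
with 1, without repetition. -/
theorem zList_nodup_mem (n : ℕ) :
    (zList n).Nodup ∧ ∀ w, w ∈ zList n ↔ IsTailWord n w := by
  induction n using Nat.strong_induction_on with
  | _ n ih =>
    have hZ : ∀ k < n, (if _h : k < n then zList k else []) = zList k := fun k hk => dif_pos hk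
    have hc := coe_zStep (Z := fun k => if _h : k < n then zList k else []) (n := n)
      (fun k hk h2 => by
        rw [hZ k hk, zList, zStep, if_pos h2])
    rw [← zList] at hc
    constructor
    · rw [← Multiset.coe_nodup, hc]
      refine nodup_layers fun k hk => ?_
      rw [hZ k hk]
      exact ih k hk
    · intro w
      rw [← Multiset.mem_coe, hc, Multiset.mem_add, Multiset.mem_singleton, Multiset.mem_sum,
        isTailWord_iff]
      refine or_congr_right (exists_congr fun s => and_congr_right fun hs => ?_)
      rw [Finset.mem_Icc] at hs
      rw [mem_layer, hZ _ (by omega)]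
      simp only [(ih (n - s) (by omega)).2]

theorem wList_nodup_mem (n : ℕ) :
    (wList n).Nodup ∧ ∀ w, w ∈ wList n ↔ w ∈ decreasingWords 1 n := by
  induction n with
  | zero =>
    refine ⟨by simp [wList], fun w => ?_⟩
    simp only [wList, List.mem_singleton, decreasingWords, Set.mem_ofPred_eq,
      List.length_eq_zero_iff]
    exact ⟨fun h => ⟨h, h ▸ isDecreasing_nil 1⟩, fun h => h.1⟩
  | succ n ih =>
    have hz := zList_nodup_mem (n + 1)
    constructor
    · rw [wList, List.nodup_append']
      refine ⟨ih.1.map fun u v h => List.append_cancel_left h, hz.1, ?_⟩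
      intro w hw hw'
      obtain ⟨u, -, rfl⟩ := List.mem_map.1 hw
      exact ((hz.2 _).1 hw').2.2 rfl
    · intro w
      rw [wList, List.mem_append, hz.2, prepend, List.mem_map]
      simp only [ih.2, decreasingWords, Set.mem_ofPred_eq, IsTailWord]
      constructor
      · rintro (⟨u, ⟨hl, hd⟩, rfl⟩ | ⟨hl, hd, -⟩)
        · exact ⟨by simp [hl], isDecreasing_cons_true.2 hd⟩
        · exact ⟨hl, hd⟩
      · rintro ⟨hl, hd⟩
        by_cases hh : w.head? = some true
        · obtain ⟨u, rfl⟩ := List.head?_eq_some_iff.1 hh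
          exact Or.inl ⟨u, ⟨by simpa using hl, isDecreasing_cons_true.1 hd⟩, rfl⟩
        · exact Or.inr ⟨hl, hd, hh⟩

end QDecreasing

theorem theorem4 (n : ℕ) (hn : 1 ≤ n) :
    QDecreasing.IsGrayCode 1 n (QDecreasing.decreasingWords 1 n) (QDecreasing.wList n) ∧
      (QDecreasing.wList n).head? = some (QDecreasing.ones n) ∧
      (QDecreasing.wList n).getLast? = some (QDecreasing.prefix001 n) := by
  have hp := QDecreasing.isPath_wList n
  have hm := QDecreasing.wList_nodup_mem n
  exact ⟨⟨fun w hw => hw.1, hm.1, hm.2, hp.chain⟩, hp.head, hp.last⟩
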